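/- Let $r,n\ge 1$ be integers and $\mathbb Z_n=\mathbb Z/n\mathbb Z$. Let $\chi$ be a (complex) multiplicative character of $\mathbb Z_n^*$ with conductor $f$, i.e. $f$ is the smallest positive divisor of $n$ such that $\chi$ factors through $\mathbb Z_f^*$. Let $\lambda$ be a (complex) additive character of $\mathbb Z_n$ of order $n/d$ (equivalently, $\lambda(x)=\exp(2\pi\sqrt{-1}\,ax/n)$ for some $a\in\mathbb Z$ with $d=\gcd(a,n)$). Put $$G(\mathrm{GL}_r(\mathbb Z_n),\chi,\lambda)=\sum_{X\in \mathrm{GL}_r(\mathbb Z_n)}\chi(\det X)\,\lambda(\operatorname{tr}X).$$ If $f\mid n/d$ and $n/(df)$ is squarefree and coprime to $f$, then $$|G(\mathrm{GL}_r(\mathbb Z_n),\chi,\lambda)|=n^{r(r-1)/2}\,d^{\,r(r+1)/2}\,f^{\,r/2}\prod_{\substack{p\mid n\\ p\nmid n/d}}\ \prod_{i=1}^r\bigl(1-p^{-i}\bigr),$$ where $p$ runs over the primes dividing $n$ but not $n/d$. Otherwise (i.e. if any of these three conditions fails) $G(\mathrm{GL}_r(\mathbb Z_n),\chi,\lambda)=0$.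 -/

import Mathlib

open Matrix Finset

/-- The Gauss sum `G(GL_r(ℤ/n), χ, ψ) = ∑ χ(det X) ψ(tr X)`, over all `X` in `GL_r(ℤ/n)`, of a
multiplicative character `χ` and an additive character `ψ` modulo `n`. -/
noncomputable def gaussSumGL (r n : ℕ) [NeZero n] (χ : DirichletCharacter ℂ n)
    (ψ : AddChar (ZMod n) ℂ) : ℂ :=
  ∑ X : GL (Fin r) (ZMod n),
    χ (X : Matrix (Fin r) (Fin r) (ZMod n)).det *
      ψ (X : Matrix (Fin r) (Fin r) (ZMod n)).trace

/-- The Gauss sum of a primitive Dirichlet character has absolute value the square root of the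
level. -/
lemma norm_gaussSum_sq_of_isPrimitive {N : ℕ} [NeZero N] {χ : DirichletCharacter ℂ N}
    (hχ : χ.IsPrimitive) {e : AddChar (ZMod N) ℂ} (he : e.IsPrimitive) :
    ‖gaussSum χ e‖ ^ 2 = N := by
  have key : gaussSum χ e * star (gaussSum χ e) = N := by
    rw [star_gaussSum_eq]
    conv_lhs => rw [mul_comm, gaussSum, sum_mul]
    have h1 : ∀ a : ZMod N, χ⁻¹ a * e⁻¹ a * gaussSum χ e
        = ∑ b, χ b * e (a * (b - 1)) := by
      intro a
      rw [mul_right_comm, ← gaussSum_mulShift_of_isPrimitive e hχ a, gaussSum, sum_mul]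
      refine sum_congr rfl fun b _ => ?_
      rw [mul_assoc, AddChar.mulShift_apply, AddChar.inv_apply, ← AddChar.map_add_eq_mul]
      congr 2; ring
    simp_rw [h1]
    rw [sum_comm]
    simp_rw [← mul_sum, AddChar.sum_mulShift _ he, sub_eq_zero]
    simp [ZMod.card]
  have h2 : ((‖gaussSum χ e‖ ^ 2 : ℝ) : ℂ) = (N : ℂ) := by
    rw [← key, Complex.star_def, Complex.mul_conj, Complex.normSq_eq_norm_sq]
  exact_mod_cast h2

section Ring

variable {R : Type*} [CommRing R]

lemma sum_GL_mulChar_det [Fintype R] [DecidableEq R] (r : ℕ) (χ : MulChar R ℂ) (F : Matrix (Fin r) (Fin r) R → ℂ) :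
    ∑ X : GL (Fin r) R, χ (X : Matrix (Fin r) (Fin r) R).det * F X =
      ∑ X : Matrix (Fin r) (Fin r) R, χ X.det * F X := by
  refine sum_of_injOn (fun X : GL (Fin r) R => (X : Matrix (Fin r) (Fin r) R))
    (fun a _ b _ h => Units.ext h) (fun _ _ => mem_coe.2 (mem_univ _)) ?_ fun _ _ => rfl
  intro X _ hX
  rw [χ.map_nonunit, zero_mul]
  intro h
  rw [← Matrix.isUnit_iff_isUnit_det] at h
  exact hX ⟨h.unit, mem_coe.2 (mem_univ _), rfl⟩

/-- The strictly upper triangular part of a matrix. -/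
def strictUpper (r : ℕ) : Matrix (Fin r) (Fin r) R →+ Matrix (Fin r) (Fin r) R where
  toFun X := Matrix.of fun i j => if i < j then X i j else 0
  map_zero' := by ext; simp
  map_add' X Y := by ext i j; by_cases h : i < j <;> simp [h]

lemma strictUpper_apply {r : ℕ} (X : Matrix (Fin r) (Fin r) R) (i j : Fin r) :
    strictUpper r X i j = if i < j then X i j else 0 := rfl

lemma det_one_add_strictUpper {r : ℕ} (X : Matrix (Fin r) (Fin r) R) :
    (1 + strictUpper r X).det = 1 := by
  rw [Matrix.det_of_isUpperTriangular]
  · simp [strictUpper_apply]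
  · intro i j h
    have h' : j < i := h
    simp [strictUpper_apply, h'.not_gt, h'.ne']

lemma trace_strictUpper_mul {r : ℕ} (X Y : Matrix (Fin r) (Fin r) R) :
    (strictUpper r Y * X).trace = ∑ i, ∑ j, if i < j then Y i j * X j i else 0 := by
  simp [Matrix.trace, Matrix.mul_apply, strictUpper_apply, ite_mul]

/-- Averaging over unipotent upper triangular translates reduces the sum to upper triangular
matrices. -/
lemma sum_mulChar_det_mul_addChar_trace_eq_sum_upper [Fintype R] [DecidableEq R] (r : ℕ) (χ : MulChar R ℂ)
    {ψ : AddChar R ℂ} (hψ : ψ.IsPrimitive) :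
    ∑ X : Matrix (Fin r) (Fin r) R, χ X.det * ψ X.trace =
      ∑ X : Matrix (Fin r) (Fin r) R,
        if ∀ i j, i < j → X j i = 0 then χ X.det * ψ X.trace else 0 := by
  set c : ℂ := (Fintype.card (Matrix (Fin r) (Fin r) R) : ℂ) with hc
  have hc0 : c ≠ 0 := by
    rw [hc]; exact_mod_cast Fintype.card_ne_zero
  apply mul_left_cancel₀ hc0
  have h1 : ∀ Y : Matrix (Fin r) (Fin r) R,
      ∑ X : Matrix (Fin r) (Fin r) R, χ X.det * ψ X.trace =
      ∑ X : Matrix (Fin r) (Fin r) R,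
        χ X.det * ψ X.trace * ψ (strictUpper r Y * X).trace := by
    intro Y
    have hu : IsUnit (1 + strictUpper r Y) := by
      rw [Matrix.isUnit_iff_isUnit_det, det_one_add_strictUpper]; exact isUnit_one
    obtain ⟨u, hu⟩ := hu
    rw [← Equiv.sum_comp (Units.mulLeft u)]
    refine sum_congr rfl fun X _ => ?_
    simp only [Units.mulLeft_apply, hu]
    rw [Matrix.det_mul, det_one_add_strictUpper, one_mul, add_mul,
      one_mul, Matrix.trace_add, AddChar.map_add_eq_mul, mul_assoc]
  have h2 : ∀ X : Matrix (Fin r) (Fin r) R,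
      ∑ Y : Matrix (Fin r) (Fin r) R, ψ (strictUpper r Y * X).trace =
        if ∀ i j, i < j → X j i = 0 then c else 0 := by
    intro X
    let φ : AddChar (Matrix (Fin r) (Fin r) R) ℂ := ψ.compAddMonoidHom
      ((Matrix.traceAddMonoidHom (Fin r) R).comp
        ((AddMonoidHom.mulRight X).comp (strictUpper r)))
    have hφ : ∀ Y, φ Y = ψ (strictUpper r Y * X).trace := fun Y => rfl
    simp_rw [← hφ]
    classical
    rw [AddChar.sum_eq_ite]
    refine if_congr ?_ rfl rfl
    rw [AddChar.eq_zero_iff]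
    constructor
    · intro h i j hij
      by_contra hx
      refine hψ hx ?_
      ext a
      have := h (Matrix.single i j a)
      rw [hφ, trace_strictUpper_mul, sum_eq_single i, sum_eq_single j] at this
      · simpa [hij, mul_comm] using this
      · intro k _ hk; simp [hk.symm]
      · simp
      · intro k _ hk; simp [hk.symm]
      · simp
    · intro h Y
      rw [hφ, trace_strictUpper_mul]
      rw [sum_eq_zero, AddChar.map_zero_eq_one]
      intro i _
      refine sum_eq_zero fun j _ => ?_
      split_ifs with hij
      · rw [h i j hij, mul_zero]
      · rfl
  calc c * ∑ X : Matrix (Fin r) (Fin r) R, χ X.det * ψ X.trace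
      = ∑ Y : Matrix (Fin r) (Fin r) R, ∑ X : Matrix (Fin r) (Fin r) R,
        χ X.det * ψ X.trace * ψ (strictUpper r Y * X).trace := by
        rw [← sum_congr rfl fun Y _ => h1 Y, sum_const, nsmul_eq_mul, hc, card_univ]
    _ = _ := by
        rw [sum_comm, mul_sum]
        refine sum_congr rfl fun X _ => ?_
        rw [← mul_sum, h2]
        split_ifs <;> ring

/-- The Gauss sum over `GL_r` of a finite ring for a primitive additive character. -/
lemma sum_mulChar_det_mul_addChar_trace [Fintype R] [DecidableEq R] (r : ℕ) (χ : MulChar R ℂ)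
    {ψ : AddChar R ℂ} (hψ : ψ.IsPrimitive) :
    ∑ X : Matrix (Fin r) (Fin r) R, χ X.det * ψ X.trace =
      (Fintype.card R : ℂ) ^ (r * (r - 1) / 2) * gaussSum χ ψ ^ r := by
  rw [sum_mulChar_det_mul_addChar_trace_eq_sum_upper r χ hψ]
  let F : Fin r → Fin r → R → ℂ := fun i j a =>
    if i = j then χ a * ψ a else if i < j then 1 else if a = 0 then 1 else 0
  have hF : ∀ X : Matrix (Fin r) (Fin r) R,
      (if ∀ i j, i < j → X j i = 0 then χ X.det * ψ X.trace else 0) =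
        ∏ i, ∏ j, F i j (X i j) := by
    intro X
    split_ifs with h
    · have : X.BlockTriangular id := fun i j hij => h j i hij
      rw [Matrix.det_of_isUpperTriangular this, Matrix.trace, map_prod]
      have hs : ψ (∑ i, X.diag i) = ∏ i, ψ (X i i) :=
        map_prod ψ.toMonoidHom (fun i => Multiplicative.ofAdd (X i i)) univ
      rw [hs, ← prod_mul_distrib]
      refine prod_congr rfl fun i _ => ?_
      rw [prod_eq_single i]
      · simp [F]
      · intro j _ hj
        rcases lt_or_gt_of_ne hj with hj' | hj'
        · simp [F, hj.symm, hj'.not_gt, h j i hj']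
        · simp [F, hj.symm, hj']
      · simp
    · push Not at h
      obtain ⟨i, j, hij, hx⟩ := h
      symm
      refine prod_eq_zero (mem_univ j) (prod_eq_zero (mem_univ i) ?_)
      simp [F, hij.ne', hij.not_gt, hx]
  rw [sum_congr rfl fun X _ => hF X]
  have hprod : ∑ X : Matrix (Fin r) (Fin r) R, ∏ i, ∏ j, F i j (X i j) =
      ∏ i, ∏ j, ∑ a, F i j a := by
    have h1 : ∀ i, ∏ j, ∑ a, F i j a = ∑ v : Fin r → R, ∏ j, F i j (v j) := fun i => by
      rw [Finset.prod_univ_sum]; simp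
    simp_rw [h1]
    rw [Finset.prod_univ_sum]
    simp only [Fintype.piFinset_univ]
    rfl
  rw [hprod]
  have hFs : ∀ i j, ∑ a, F i j a =
      (if i = j then gaussSum χ ψ else 1) * (if i < j then (Fintype.card R : ℂ) else 1) := by
    intro i j
    rcases lt_trichotomy i j with h | h | h
    · simp [F, h, h.ne]
    · subst h; simp [F, gaussSum]
    · simp [F, h.ne', h.not_gt]
  simp_rw [hFs, prod_mul_distrib, prod_ite_eq, mem_univ, if_true, prod_const, card_univ,
    Fintype.card_fin]
  rw [mul_comm]
  congr 1
  simp_rw [prod_ite, prod_const_one, mul_one, prod_const]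
  rw [prod_pow_eq_pow_sum]
  congr 1
  rw [← Finset.sum_range_id, ← Fin.sum_univ_eq_sum_range (fun i => i),
    ← Equiv.sum_comp Fin.revPerm]
  refine sum_congr rfl fun i _ => ?_
  rw [Finset.filter_lt_eq_Ioi, Fin.card_Ioi, Fin.revPerm_apply, Fin.val_rev]
  omega

end Ring

@[to_additive]
lemma sum_comp_of_monoidHom_surjective {G H : Type*} [Group G] [Group H] [Fintype G] [Fintype H]
    (f : G →* H) (hf : Function.Surjective f) (F : H → ℂ) :
    (Fintype.card H : ℂ) * ∑ g, F (f g) = Fintype.card G * ∑ h, F h := by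
  classical
  have h1 : ∀ h, #{g | f g = h} = #{g | f g = 1} := fun h =>
    MonoidHom.card_fiber_eq_of_mem_range f (hf h) (hf 1)
  have h2 : ∀ F : H → ℂ, ∑ g, F (f g) = #{g | f g = 1} * ∑ h, F h := by
    intro F
    rw [← sum_fiberwise univ f, mul_sum]
    refine sum_congr rfl fun h _ => ?_
    rw [sum_congr rfl (g := fun _ => F h), sum_const, h1, nsmul_eq_mul]
    intro g hg
    rw [(mem_filter.1 hg).2]
  have h3 := h2 fun _ => 1
  simp only [sum_const, nsmul_eq_mul, mul_one, card_univ] at h3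
  rw [h2, h3]
  ring

lemma ZMod.isUnit_iff_forall_prime {n : ℕ} [NeZero n] (a : ZMod n) :
    IsUnit a ↔ ∀ p (_ : p.Prime) (h : p ∣ n), ZMod.castHom h (ZMod p) a ≠ 0 := by
  have ha : ((a.val : ℕ) : ZMod n) = a := by simp
  have h0 : ∀ p (h : p ∣ n), ZMod.castHom h (ZMod p) a = 0 ↔ p ∣ a.val := by
    intro p h
    rw [← ZMod.natCast_eq_zero_iff, ← map_natCast (ZMod.castHom h (ZMod p)), ha]
  conv_lhs => rw [← ha]
  rw [ZMod.isUnit_iff_coprime]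
  constructor
  · intro hc p hp h h'
    rw [h0] at h'
    exact Nat.not_coprime_of_dvd_of_dvd hp.one_lt h' h hc
  · intro hp
    refine Nat.coprime_of_dvd fun p hp' h h' => hp p hp' h' ((h0 p h').2 h)

lemma ZMod.castHom_castHom {p m n : ℕ} (h : p ∣ m) (h' : m ∣ n) (a : ZMod n) :
    ZMod.castHom h (ZMod p) (ZMod.castHom h' (ZMod m) a) =
      ZMod.castHom (h.trans h') (ZMod p) a := by
  rw [← RingHom.comp_apply]
  congr 1
  exact Subsingleton.elim _ _

section Card

/-- The order of `GL_r(R)`. -/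
lemma card_GL_eq_card_isUnit_det (r : ℕ) (R : Type*) [CommRing R] :
    Nat.card (GL (Fin r) R) = Nat.card {M : Matrix (Fin r) (Fin r) R // IsUnit M.det} :=
  Nat.card_congr
    { toFun := fun X => ⟨X, (Matrix.isUnit_iff_isUnit_det _).1 X.isUnit⟩
      invFun := fun M => ((Matrix.isUnit_iff_isUnit_det _).2 M.2).unit
      left_inv := fun _ => Units.ext rfl
      right_inv := fun _ => rfl }

lemma card_GL_prod (r : ℕ) (R S : Type*) [CommRing R] [CommRing S] :
    Nat.card (GL (Fin r) (R × S)) = Nat.card (GL (Fin r) R) * Nat.card (GL (Fin r) S) := by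
  rw [card_GL_eq_card_isUnit_det, card_GL_eq_card_isUnit_det, card_GL_eq_card_isUnit_det,
    ← Nat.card_prod]
  let E : Matrix (Fin r) (Fin r) (R × S) ≃ Matrix (Fin r) (Fin r) R × Matrix (Fin r) (Fin r) S :=
    { toFun := fun M => ((RingHom.fst R S).mapMatrix M, (RingHom.snd R S).mapMatrix M)
      invFun := fun M => Matrix.of fun i j => (M.1 i j, M.2 i j)
      left_inv := fun _ => rfl
      right_inv := fun _ => rfl }
  refine Nat.card_congr ((E.subtypeEquiv fun M => ?_).trans Equiv.subtypeProdEquivProd)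
  change IsUnit M.det ↔ IsUnit ((RingHom.fst R S).mapMatrix M).det ∧
    IsUnit ((RingHom.snd R S).mapMatrix M).det
  rw [← RingHom.map_det, ← RingHom.map_det, Prod.isUnit_iff]
  rfl

lemma card_GL_mul_of_coprime (r : ℕ) {a b : ℕ} (hab : a.Coprime b) :
    Nat.card (GL (Fin r) (ZMod (a * b))) =
      Nat.card (GL (Fin r) (ZMod a)) * Nat.card (GL (Fin r) (ZMod b)) := by
  rw [← card_GL_prod]
  exact Nat.card_congr
    (Units.mapEquiv (ZMod.chineseRemainder hab).mapMatrix.toMulEquiv).toEquiv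

lemma card_GL_of_primes_dvd (r : ℕ) {m n : ℕ} [NeZero n] (h : m ∣ n)
    (hp : ∀ p, p.Prime → p ∣ n → p ∣ m) :
    Nat.card (GL (Fin r) (ZMod n)) = (n / m) ^ (r ^ 2) * Nat.card (GL (Fin r) (ZMod m)) := by
  classical
  have : NeZero m := ⟨fun h0 => NeZero.ne n (Nat.eq_zero_of_zero_dvd (h0 ▸ h))⟩
  rw [card_GL_eq_card_isUnit_det, card_GL_eq_card_isUnit_det]
  let f := (ZMod.castHom h (ZMod m)).mapMatrix (m := Fin r)
  have hf : Function.Surjective f := by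
    intro X
    choose Y hY using fun i j => ZMod.castHom_surjective h (X i j)
    exact ⟨Matrix.of Y, by ext i j; exact hY i j⟩
  have hu : ∀ M : Matrix (Fin r) (Fin r) (ZMod n), IsUnit M.det ↔ IsUnit (f M).det := by
    intro M
    rw [← RingHom.map_det, ZMod.isUnit_iff_forall_prime, ZMod.isUnit_iff_forall_prime]
    constructor
    · intro H p hp' hpm
      rw [ZMod.castHom_castHom]
      exact H p hp' (hpm.trans h)
    · intro H p hp' hpn
      rw [← ZMod.castHom_castHom (hp p hp' hpn) h]
      exact H p hp' (hp p hp' hpn)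
  have key := sum_comp_of_addMonoidHom_surjective f.toAddMonoidHom hf
    (fun M => if IsUnit M.det then 1 else 0)
  have h1 : ∑ M, (if IsUnit (f M).det then (1 : ℂ) else 0) =
      Nat.card {M : Matrix (Fin r) (Fin r) (ZMod n) // IsUnit M.det} := by
    simp_rw [← hu]
    rw [Nat.card_eq_fintype_card, Fintype.card_subtype, sum_boole]
  have h2 : ∑ M : Matrix (Fin r) (Fin r) (ZMod m), (if IsUnit M.det then (1 : ℂ) else 0) =
      Nat.card {M : Matrix (Fin r) (Fin r) (ZMod m) // IsUnit M.det} := by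
    rw [Nat.card_eq_fintype_card, Fintype.card_subtype, sum_boole]
  have hc : ∀ k : ℕ, [NeZero k] →
      Fintype.card (Matrix (Fin r) (Fin r) (ZMod k)) = k ^ (r ^ 2) := by
    intro k _
    rw [← Nat.card_eq_fintype_card, Matrix, Nat.card_fun, Nat.card_fun]
    simp [sq, ← pow_mul]
  change _ * (∑ M, if IsUnit (f M).det then (1 : ℂ) else 0) = _ at key
  rw [hc, hc, h1, h2] at key
  have key2 : m ^ (r ^ 2) * Nat.card {M : Matrix (Fin r) (Fin r) (ZMod n) // IsUnit M.det} =
      n ^ (r ^ 2) * Nat.card {M : Matrix (Fin r) (Fin r) (ZMod m) // IsUnit M.det} := by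
    exact_mod_cast key
  obtain ⟨d, rfl⟩ := h
  have hm : 0 < m := Nat.pos_of_ne_zero (NeZero.ne m)
  rw [Nat.mul_div_cancel_left _ hm]
  rw [mul_pow, mul_assoc] at key2
  exact Nat.eq_of_mul_eq_mul_left (pow_pos hm _) key2

lemma card_GL_zmod_prime (r p : ℕ) [Fact p.Prime] :
    (Nat.card (GL (Fin r) (ZMod p)) : ℝ) =
      p ^ (r ^ 2) * ∏ i ∈ Icc 1 r, (1 - 1 / (p : ℝ) ^ i) := by
  have hp : (p : ℝ) ≠ 0 := Nat.cast_ne_zero.2 (Nat.Prime.ne_zero Fact.out)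
  rw [Matrix.card_GL_field, ZMod.card, Nat.cast_prod]
  have h1 : ∀ i : Fin r, ((p ^ r - p ^ (i : ℕ) : ℕ) : ℝ) =
      p ^ r * (1 - 1 / (p : ℝ) ^ (r - (i : ℕ))) := by
    intro i
    rw [Nat.cast_sub (Nat.pow_le_pow_right (Nat.Prime.pos Fact.out) i.2.le), mul_sub, mul_one,
      mul_one_div, div_eq_mul_inv, ← pow_sub₀ _ hp (Nat.sub_le _ _), Nat.sub_sub_self i.2.le]
    push_cast
    rfl
  simp_rw [h1]
  rw [prod_mul_distrib, prod_const, card_univ, Fintype.card_fin, ← pow_mul, sq,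
    Fin.prod_univ_eq_prod_range (fun i => 1 - 1 / (p : ℝ) ^ (r - i)), range_eq_Ico,
    prod_Ico_reflect (fun i => 1 - 1 / (p : ℝ) ^ i) 0 (Nat.le_succ r)]
  congr 2
  ext i
  simp only [mem_Ico, mem_Icc]
  omega

lemma card_GL_zmod (r n : ℕ) [NeZero n] :
    (Nat.card (GL (Fin r) (ZMod n)) : ℝ) =
      n ^ (r ^ 2) * ∏ p ∈ n.primeFactors, ∏ i ∈ Icc 1 r, (1 - 1 / (p : ℝ) ^ i) := by
  have hn := NeZero.ne n
  induction n using Nat.recOnPosPrimePosCoprime with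
  | prime_pow p k hp hk =>
    have : Fact p.Prime := ⟨hp⟩
    rw [card_GL_of_primes_dvd r (dvd_pow_self p hk.ne')
      (fun q hq h => hq.dvd_of_dvd_pow h |> fun h' => h'), Nat.cast_mul, card_GL_zmod_prime,
      Nat.primeFactors_prime_pow hk.ne' hp, prod_singleton, ← mul_assoc]
    congr 1
    rw [← Nat.cast_pow, ← Nat.cast_pow, ← Nat.cast_mul, ← mul_pow,
      Nat.div_mul_cancel (dvd_pow_self p hk.ne')]
  | zero => exact absurd rfl hn
  | one =>
    have : Subsingleton (GL (Fin r) (ZMod 1)) := ⟨fun a b => Units.ext (Subsingleton.elim _ _)⟩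
    simp
  | coprime a b ha hb hab iha ihb =>
    have : NeZero a := ⟨by omega⟩
    have : NeZero b := ⟨by omega⟩
    rw [card_GL_mul_of_coprime r hab, Nat.cast_mul, iha (NeZero.ne a), ihb (NeZero.ne b),
      hab.primeFactors_mul, prod_union hab.disjoint_primeFactors]
    push_cast
    ring

end Card

lemma GL_map_castHom_surjective (r : ℕ) {m n : ℕ} [NeZero n] (h : m ∣ n) :
    Function.Surjective (Matrix.GeneralLinearGroup.map (n := Fin r) (ZMod.castHom h (ZMod m))) := by
  intro X
  have : NeZero m := ⟨fun h0 => NeZero.ne n (Nat.eq_zero_of_zero_dvd (h0 ▸ h))⟩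
  set P := ∏ p ∈ n.primeFactors.filter (fun p => ¬ p ∣ m), p with hP
  have hco : m.Coprime P := by
    refine Nat.Coprime.prod_right fun p hp => ?_
    rw [mem_filter] at hp
    exact ((Nat.Prime.coprime_iff_not_dvd (Nat.prime_of_mem_primeFactors hp.1)).2 hp.2).symm
  obtain ⟨e, he1, he0⟩ := Nat.chineseRemainder hco 1 0
  choose Y hY using fun i j => ZMod.castHom_surjective h
    ((X : Matrix (Fin r) (Fin r) (ZMod m)) i j)
  let A : Matrix (Fin r) (Fin r) (ZMod n) := (e : ZMod n) • Matrix.of Y + (1 - (e : ZMod n)) • 1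
  have hAm : (ZMod.castHom h (ZMod m)).mapMatrix A = X := by
    have : (e : ZMod m) = 1 := by
      simpa using (ZMod.natCast_eq_natCast_iff _ _ _).2 he1
    ext i j
    change ZMod.castHom h (ZMod m) ((e : ZMod n) * Y i j + (1 - (e : ZMod n)) * _) = _
    simp [-ZMod.castHom_apply, this, hY]
  have hAp : ∀ p (hp : p.Prime) (hpn : p ∣ n), ¬ p ∣ m →
      (ZMod.castHom hpn (ZMod p)).mapMatrix A = 1 := by
    intro p hp hpn hpm
    have : (e : ZMod p) = 0 := by
      rw [ZMod.natCast_eq_zero_iff]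
      refine (dvd_prod_of_mem _ ?_ : p ∣ P).trans ((Nat.modEq_zero_iff_dvd).1 he0)
      exact mem_filter.2 ⟨Nat.mem_primeFactors.2 ⟨hp, hpn, NeZero.ne n⟩, hpm⟩
    ext i j
    change ZMod.castHom hpn (ZMod p) ((e : ZMod n) * Y i j + (1 - (e : ZMod n)) *
      (1 : Matrix (Fin r) (Fin r) (ZMod n)) i j) = _
    by_cases hij : i = j <;> simp [-ZMod.castHom_apply, this, hij, Matrix.one_apply]
  have hdet : IsUnit A.det := by
    rw [ZMod.isUnit_iff_forall_prime]
    intro p hp hpn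
    have : Fact p.Prime := ⟨hp⟩
    by_cases hpm : p ∣ m
    · rw [← ZMod.castHom_castHom hpm h, RingHom.map_det, hAm]
      exact (ZMod.isUnit_iff_forall_prime _).1
        ((Matrix.isUnit_iff_isUnit_det _).1 X.isUnit) p hp hpm
    · rw [RingHom.map_det, hAp p hp hpn hpm, Matrix.det_one]
      exact one_ne_zero
  refine ⟨((Matrix.isUnit_iff_isUnit_det _).2 hdet).unit, Units.ext ?_⟩
  exact hAm

lemma ZMod.sum_eq_sum_range {N : ℕ} [NeZero N] (h : ℕ → ℂ) :
    ∑ a : ZMod N, h a.val = ∑ y ∈ range N, h y := by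
  refine sum_nbij (fun a => a.val) (fun a _ => mem_range.2 a.val_lt)
    (fun a _ b _ h => ZMod.val_injective N h) ?_ fun _ _ => rfl
  intro y hy
  exact ⟨(y : ZMod N), mem_coe.2 (mem_univ _), ZMod.val_cast_of_lt (mem_range.1 hy)⟩

lemma sum_range_periodic_mul_pow_eq_zero {f N : ℕ} [NeZero N] (hf : f ∣ N) (hlt : f < N)
    (g : ZMod f → ℂ) {η : ℂ} (hη : IsPrimitiveRoot η N) :
    ∑ y ∈ range N, g y * η ^ y = 0 := by
  let e := AddChar.zmodChar N hη.pow_eq_one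
  have h1 : ∑ y ∈ range N, g y * η ^ y = ∑ a : ZMod N, g (ZMod.castHom hf (ZMod f) a) * e a := by
    rw [← ZMod.sum_eq_sum_range]
    refine sum_congr rfl fun a _ => ?_
    rw [AddChar.zmodChar_apply]
    congr 2
    conv_rhs => rw [← ZMod.natCast_zmod_val a, map_natCast]
  have h2 : e (f : ZMod N) ≠ 1 := by
    rw [AddChar.zmodChar_apply' hη.pow_eq_one]
    exact hη.pow_ne_one_of_pos_of_lt (fun h0 => by
      subst h0; exact NeZero.ne N (Nat.eq_zero_of_zero_dvd hf)) hlt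
  have h3 : (∑ a : ZMod N, g (ZMod.castHom hf (ZMod f) a) * e a) * e (f : ZMod N) =
      ∑ a : ZMod N, g (ZMod.castHom hf (ZMod f) a) * e a := by
    conv_rhs => rw [← Equiv.sum_comp (Equiv.addRight (f : ZMod N))]
    rw [sum_mul]
    refine sum_congr rfl fun a _ => ?_
    simp only [Equiv.coe_addRight]
    rw [map_add (ZMod.castHom hf (ZMod f)), map_natCast (ZMod.castHom hf (ZMod f)),
      ZMod.natCast_self, add_zero, AddChar.map_add_eq_mul, mul_assoc]
  rw [h1]
  by_contra h
  exact h2 (mul_left_cancel₀ h (h3.trans (mul_one _).symm))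

lemma sum_range_dvd {m k : ℕ} (hk : 0 < k) (h : k ∣ m) (F : ℕ → ℂ) :
    ∑ x ∈ (range m).filter (k ∣ ·), F x = ∑ y ∈ range (m / k), F (k * y) := by
  symm
  refine sum_nbij (k * ·) ?_ ?_ ?_ fun _ _ => rfl
  · intro y hy
    rw [mem_filter, mem_range]
    exact ⟨by rw [mem_range, Nat.lt_div_iff_mul_lt_of_dvd hk.ne' h, mul_comm] at hy; exact hy, dvd_mul_right _ _⟩
  · intro a _ b _ hab
    exact Nat.eq_of_mul_eq_mul_left hk hab
  · rintro x hx
    rw [mem_coe, mem_filter, mem_range] at hx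
    obtain ⟨hx, y, rfl⟩ := hx
    exact ⟨y, by rw [mem_coe, mem_range, Nat.lt_div_iff_mul_lt_of_dvd hk.ne' h, mul_comm]; exact hx, rfl⟩

lemma sum_moebius_eq_ite_coprime {m : ℕ} (hm : m ≠ 0) (x : ℕ) :
    ∑ k ∈ m.divisors.filter (· ∣ x), ArithmeticFunction.moebius k =
      if x.Coprime m then 1 else 0 := by
  have : m.divisors.filter (· ∣ x) = (x.gcd m).divisors := by
    ext k
    simp [Nat.dvd_gcd_iff, hm, and_comm]
  rw [this, ← ArithmeticFunction.coe_mul_zeta_apply, ArithmeticFunction.moebius_mul_coe_zeta,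
    ArithmeticFunction.one_apply]

/-- The Gauss sum of a Dirichlet character in terms of that of the underlying primitive
character. -/
lemma gaussSum_eq_moebius_mul_gaussSum_primitiveCharacter {m : ℕ} [NeZero m]
    (χ : DirichletCharacter ℂ m) {ζ : ℂ} (hζ : IsPrimitiveRoot ζ m) :
    gaussSum χ (AddChar.zmodChar m hζ.pow_eq_one) =
      ArithmeticFunction.moebius (m / χ.conductor) * (χ.primitiveCharacter (m / χ.conductor : ℕ) *
        ∑ y ∈ range χ.conductor, χ.primitiveCharacter y * (ζ ^ (m / χ.conductor)) ^ y) := by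
  classical
  have hm := NeZero.ne m
  set f := χ.conductor with hf
  set χ0 := χ.primitiveCharacter with hχ0
  have hfm : f ∣ m := χ.conductor_dvd_level
  have hf0 : f ≠ 0 := χ.conductor_ne_zero
  have hsm : m / f ∣ m := Nat.div_dvd_of_dvd hfm
  have h1 : gaussSum χ (AddChar.zmodChar m hζ.pow_eq_one) =
      ∑ x ∈ range m, (if x.Coprime m then 1 else 0) * (χ0 x * ζ ^ x) := by
    rw [← ZMod.sum_eq_sum_range, gaussSum]
    refine sum_congr rfl fun a _ => ?_
    rw [AddChar.zmodChar_apply, ← mul_assoc]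
    congr 1
    have ha : χ a = χ ((a.val : ℕ) : ZMod m) := by rw [ZMod.natCast_zmod_val]
    rw [ha]
    split_ifs with hc
    · have := χ.primitiveCharacter_apply_of_isCoprime (Nat.isCoprime_iff_coprime.2 hc)
      simpa using this.symm
    · rw [χ.map_nonunit, zero_mul]
      rwa [ZMod.isUnit_iff_coprime]
  have h2 : ∀ x : ℕ, (if x.Coprime m then (1 : ℂ) else 0) =
      ∑ k ∈ m.divisors, if k ∣ x then (ArithmeticFunction.moebius k : ℂ) else 0 := by
    intro x
    have := sum_moebius_eq_ite_coprime hm x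
    rw [← sum_filter]
    exact_mod_cast this.symm
  have h3 : ∀ k ∈ m.divisors, ∑ x ∈ range m,
      (if k ∣ x then (ArithmeticFunction.moebius k : ℂ) else 0) * (χ0 x * ζ ^ x) =
      ArithmeticFunction.moebius k *
        (χ0 k * ∑ y ∈ range (m / k), χ0 y * (ζ ^ k) ^ y) := by
    intro k hk
    have hkm := Nat.dvd_of_mem_divisors hk
    have hk0 : 0 < k := Nat.pos_of_mem_divisors hk
    simp_rw [ite_mul, zero_mul]
    rw [← sum_filter, sum_range_dvd hk0 hkm (fun x => _ * (χ0 x * ζ ^ x)), mul_sum, mul_sum]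
    refine sum_congr rfl fun y _ => ?_
    rw [Nat.cast_mul, map_mul, pow_mul]
    ring
  rw [h1]
  simp_rw [h2, sum_mul]
  rw [sum_comm, sum_congr rfl h3, sum_eq_single (m / f)]
  · rw [Nat.div_div_self hfm hm]
  · intro k hk hne
    have hkm := Nat.dvd_of_mem_divisors hk
    have hk0 : 0 < k := Nat.pos_of_mem_divisors hk
    by_cases hkf : k.Coprime f
    · have hdvd : f ∣ m / k := by
        refine hkf.symm.dvd_of_dvd_mul_left ?_
        rwa [Nat.mul_div_cancel' hkm]
      have : NeZero (m / k) := ⟨(Nat.div_pos (Nat.le_of_dvd (Nat.pos_of_ne_zero hm) hkm) hk0).ne'⟩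
      rw [sum_range_periodic_mul_pow_eq_zero hdvd, mul_zero, mul_zero]
      · refine lt_of_le_of_ne (Nat.le_of_dvd (Nat.pos_of_ne_zero (NeZero.ne _)) hdvd) ?_
        intro h
        exact hne (by rw [h, Nat.div_div_self hkm hm])
      · exact hζ.pow (Nat.pos_of_ne_zero hm) (Nat.mul_div_cancel' hkm).symm
    · rw [χ0.map_nonunit, zero_mul, mul_zero]
      rwa [ZMod.isUnit_iff_coprime]
  · intro h
    exact absurd (Nat.mem_divisors.2 ⟨hsm, hm⟩) h

lemma gaussSum_zmodChar_eq_zero {m : ℕ} [NeZero m] (χ : DirichletCharacter ℂ m) {ζ : ℂ}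
    (hζ : IsPrimitiveRoot ζ m)
    (h : ¬ (Squarefree (m / χ.conductor) ∧ Nat.Coprime (m / χ.conductor) χ.conductor)) :
    gaussSum χ (AddChar.zmodChar m hζ.pow_eq_one) = 0 := by
  rw [gaussSum_eq_moebius_mul_gaussSum_primitiveCharacter χ hζ]
  by_cases hs : Squarefree (m / χ.conductor)
  · rw [χ.primitiveCharacter.map_nonunit, zero_mul, mul_zero]
    rw [ZMod.isUnit_iff_coprime]
    exact fun hc => h ⟨hs, hc⟩
  · rw [ArithmeticFunction.moebius_eq_zero_of_not_squarefree hs, Int.cast_zero, zero_mul]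

lemma norm_gaussSum_zmodChar_sq {m : ℕ} [NeZero m] (χ : DirichletCharacter ℂ m) {ζ : ℂ}
    (hζ : IsPrimitiveRoot ζ m) (hs : Squarefree (m / χ.conductor))
    (hc : Nat.Coprime (m / χ.conductor) χ.conductor) :
    ‖gaussSum χ (AddChar.zmodChar m hζ.pow_eq_one)‖ ^ 2 = χ.conductor := by
  have : NeZero χ.conductor := ⟨χ.conductor_ne_zero⟩
  have hη : IsPrimitiveRoot (ζ ^ (m / χ.conductor)) χ.conductor :=
    hζ.pow (Nat.pos_of_ne_zero (NeZero.ne m)) (Nat.div_mul_cancel χ.conductor_dvd_level).symm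
  have h1 : ∑ y ∈ range χ.conductor, χ.primitiveCharacter y * (ζ ^ (m / χ.conductor)) ^ y =
      gaussSum χ.primitiveCharacter (AddChar.zmodChar χ.conductor hη.pow_eq_one) := by
    rw [← ZMod.sum_eq_sum_range, gaussSum]
    refine sum_congr rfl fun a _ => ?_
    rw [AddChar.zmodChar_apply, ZMod.natCast_zmod_val]
  have hmu : ‖(ArithmeticFunction.moebius (m / χ.conductor) : ℂ)‖ = 1 := by
    rw [Complex.norm_intCast, ← Int.cast_abs,
      ArithmeticFunction.abs_moebius_eq_one_of_squarefree hs, Int.cast_one]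
  have hχ : ‖χ.primitiveCharacter (m / χ.conductor : ℕ)‖ = 1 :=
    DirichletCharacter.unit_norm_eq_one _ ((ZMod.isUnit_iff_coprime _ _).2 hc).unit
  rw [gaussSum_eq_moebius_mul_gaussSum_primitiveCharacter χ hζ, h1, norm_mul, norm_mul, hmu, hχ,
    one_mul, one_mul]
  exact norm_gaussSum_sq_of_isPrimitive χ.primitiveCharacter_isPrimitive
    (AddChar.zmodChar_primitive_of_primitive_root _ hη)

lemma AddChar.isPrimitiveRoot_apply_one {n : ℕ} [NeZero n] (ψ : AddChar (ZMod n) ℂ) :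
    IsPrimitiveRoot (ψ 1) (orderOf ψ) := by
  have : orderOf ψ = orderOf (ψ 1) := by
    rw [orderOf_eq_orderOf_iff]
    intro k
    rw [← AddChar.pow_apply]
    exact not_iff_not.1 (AddChar.zmod_char_ne_one_iff n (ψ ^ k))
  rw [this]
  exact IsPrimitiveRoot.orderOf _

lemma AddChar.apply_eq_zmodChar_castHom {n m : ℕ} [NeZero n] [NeZero m] (h : m ∣ n)
    (ψ : AddChar (ZMod n) ℂ) (hζ : ψ 1 ^ m = 1) (x : ZMod n) :
    ψ x = AddChar.zmodChar m hζ (ZMod.castHom h (ZMod m) x) := by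
  have hx : x = ((x.val : ℕ) : ZMod n) := by rw [ZMod.natCast_zmod_val]
  conv_rhs => rw [hx, map_natCast (ZMod.castHom h (ZMod m)), AddChar.zmodChar_apply' hζ]
  conv_lhs => rw [hx, ← nsmul_one, AddChar.map_nsmul_eq_pow]

/-- If `χ` does not factor through the order of `ψ`, the Gauss sum vanishes. -/
lemma gaussSumGL_eq_zero_of_not_conductor_dvd {r n m : ℕ} [NeZero n] [NeZero m] (hr : 0 < r)
    (χ : DirichletCharacter ℂ n) (ψ : AddChar (ZMod n) ℂ) (h : m ∣ n) (hζ : ψ 1 ^ m = 1)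
    (hf : ¬ χ.conductor ∣ m) : gaussSumGL r n χ ψ = 0 := by
  obtain ⟨u, hu, hχu⟩ : ∃ u : (ZMod n)ˣ, ZMod.unitsMap h u = 1 ∧ χ u ≠ 1 := by
    by_contra! hcon
    refine hf (χ.conductor_dvd_of_mem_conductorSet ?_)
    rw [DirichletCharacter.mem_conductorSet_iff,
      DirichletCharacter.factorsThrough_iff_ker_unitsMap h]
    intro u hu
    rw [MonoidHom.mem_ker] at hu ⊢
    exact Units.ext (hcon u hu)
  have hu' : ZMod.castHom h (ZMod m) (u : ZMod n) = 1 := congrArg Units.val hu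
  let i0 : Fin r := ⟨0, hr⟩
  let g : Matrix (Fin r) (Fin r) (ZMod n) := Matrix.diagonal (Function.update 1 i0 (u : ZMod n))
  have hdet : g.det = u := by
    rw [Matrix.det_diagonal, prod_update_of_mem (mem_univ _)]
    simp
  obtain ⟨v, hv⟩ : IsUnit g := by
    rw [Matrix.isUnit_iff_isUnit_det, hdet]
    exact u.isUnit
  have hψ : ∀ X : Matrix (Fin r) (Fin r) (ZMod n), ψ (g * X).trace = ψ X.trace := by
    intro X
    refine (AddChar.apply_eq_zmodChar_castHom h ψ hζ _).trans
      (Eq.trans ?_ (AddChar.apply_eq_zmodChar_castHom h ψ hζ _).symm)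
    congr 1
    simp only [Matrix.trace, map_sum, Matrix.diag_apply, g, Matrix.diagonal_mul, map_mul]
    refine sum_congr rfl fun i _ => ?_
    rcases eq_or_ne i i0 with rfl | hi
    · rw [Function.update_self, hu', one_mul]
    · rw [Function.update_of_ne hi, Pi.one_apply, map_one, one_mul]
  rw [gaussSumGL, sum_GL_mulChar_det r χ (fun X => ψ X.trace)]
  set S := ∑ X : Matrix (Fin r) (Fin r) (ZMod n), χ X.det * ψ X.trace with hS
  have h1 : χ u * S = S := by
    conv_rhs => rw [hS, ← Equiv.sum_comp (Units.mulLeft v)]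
    rw [hS, mul_sum]
    refine sum_congr rfl fun X _ => ?_
    simp only [Units.mulLeft_apply, hv]
    rw [hψ, Matrix.det_mul, hdet, map_mul, mul_assoc]
  by_contra hne
  exact hχu (mul_right_cancel₀ hne (h1.trans (one_mul _).symm))

/-- Reduction of the Gauss sum to the level of the additive character. -/
lemma card_mul_gaussSumGL {r n m : ℕ} [NeZero n] [NeZero m] (h : m ∣ n)
    (χ' : DirichletCharacter ℂ m) (ψ : AddChar (ZMod n) ℂ) (hζ : IsPrimitiveRoot (ψ 1) m) :
    (Nat.card (GL (Fin r) (ZMod m)) : ℂ) *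
        gaussSumGL r n (DirichletCharacter.changeLevel h χ') ψ =
      Nat.card (GL (Fin r) (ZMod n)) * ((m : ℂ) ^ (r * (r - 1) / 2) *
        gaussSum χ' (AddChar.zmodChar m hζ.pow_eq_one) ^ r) := by
  set e := AddChar.zmodChar m hζ.pow_eq_one with he
  have key := sum_comp_of_monoidHom_surjective
    (Matrix.GeneralLinearGroup.map (n := Fin r) (ZMod.castHom h (ZMod m)))
    (GL_map_castHom_surjective r h)
    (fun Y => χ' (Y : Matrix (Fin r) (Fin r) (ZMod m)).det *
      e (Y : Matrix (Fin r) (Fin r) (ZMod m)).trace)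
  rw [sum_GL_mulChar_det r χ' (fun X => e X.trace), sum_mulChar_det_mul_addChar_trace r χ'
    (AddChar.zmodChar_primitive_of_primitive_root _ hζ), ZMod.card] at key
  rw [Nat.card_eq_fintype_card, Nat.card_eq_fintype_card, ← key, gaussSumGL]
  congr 1
  refine sum_congr rfl fun X _ => ?_
  have hX : IsUnit (X : Matrix (Fin r) (Fin r) (ZMod n)).det :=
    (Matrix.isUnit_iff_isUnit_det _).1 X.isUnit
  congr 1
  · have h1 := DirichletCharacter.changeLevel_eq_cast_of_dvd χ' h hX.unit
    rw [IsUnit.unit_spec] at h1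
    rw [h1]
    congr 1
    exact RingHom.map_det (ZMod.castHom h (ZMod m)) _
  · rw [AddChar.apply_eq_zmodChar_castHom h ψ hζ.pow_eq_one]
    congr 1
    simp only [Matrix.trace, map_sum]
    rfl

theorem mainTheorem9 (r n d : ℕ) [NeZero n] (hr : 0 < r) (χ : DirichletCharacter ℂ n)
    (ψ : AddChar (ZMod n) ℂ) (hd : n = d * orderOf ψ) :
    ((χ.conductor ∣ n / d ∧ Squarefree (n / (d * χ.conductor)) ∧
        Nat.Coprime (n / (d * χ.conductor)) χ.conductor) →
      ‖gaussSumGL r n χ ψ‖ =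
        (n : ℝ) ^ (r * (r - 1) / 2) * (d : ℝ) ^ (r * (r + 1) / 2) *
          (χ.conductor : ℝ) ^ ((r : ℝ) / 2) *
          ∏ p ∈ n.primeFactors.filter (fun p => ¬ p ∣ n / d),
            ∏ i ∈ Finset.Icc 1 r, (1 - 1 / (p : ℝ) ^ i)) ∧
    (¬ (χ.conductor ∣ n / d ∧ Squarefree (n / (d * χ.conductor)) ∧
        Nat.Coprime (n / (d * χ.conductor)) χ.conductor) →
      gaussSumGL r n χ ψ = 0) := by
  have hζ := AddChar.isPrimitiveRoot_apply_one ψ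
  set m := orderOf ψ with hm
  have hn := NeZero.ne n
  have hd0 : d ≠ 0 := fun h => hn (by rw [hd, h, zero_mul])
  have : NeZero m := ⟨fun h => hn (by rw [hd, h, mul_zero])⟩
  have hmn : m ∣ n := ⟨d, by rw [hd, mul_comm]⟩
  have hnd : n / d = m := by
    conv_lhs => rw [hd, Nat.mul_div_cancel_left _ (Nat.pos_of_ne_zero hd0)]
  rw [← Nat.div_div_eq_div_mul, hnd]
  by_cases hf : χ.conductor ∣ m
  swap
  · exact ⟨fun h => absurd h.1 hf, fun _ =>
      gaussSumGL_eq_zero_of_not_conductor_dvd hr χ ψ hmn hζ.pow_eq_one hf⟩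
  obtain ⟨χ', hχ'⟩ : ∃ χ' : DirichletCharacter ℂ m,
      χ = DirichletCharacter.changeLevel hmn χ' := by
    obtain ⟨_, h⟩ := (χ.mem_conductorSet_iff_conductor_dvd hmn).2 hf
    exact h
  have hcond : χ'.conductor = χ.conductor := by
    rw [hχ', DirichletCharacter.conductor_changeLevel]
  have key := card_mul_gaussSumGL (r := r) hmn χ' ψ hζ
  rw [← hχ'] at key
  rw [← hcond] at hf ⊢
  have hcard : (Nat.card (GL (Fin r) (ZMod m)) : ℂ) ≠ 0 := Nat.cast_ne_zero.2 Nat.card_pos.ne'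
  constructor
  · rintro ⟨-, hs, hc⟩
    have hτ := norm_gaussSum_zmodChar_sq χ' hζ hs hc
    have hτr : ‖gaussSum χ' (AddChar.zmodChar m hζ.pow_eq_one)‖ ^ r =
        (χ'.conductor : ℝ) ^ ((r : ℝ) / 2) := by
      rw [← hτ, ← Real.rpow_natCast_mul (norm_nonneg _), ← Real.rpow_natCast]
      congr 1
      push_cast
      ring
    have hnorm := congrArg (‖·‖) key
    simp only [norm_mul, norm_pow, Complex.norm_natCast] at hnorm
    rw [hτr] at hnorm
    have hcard' : (Nat.card (GL (Fin r) (ZMod m)) : ℝ) ≠ 0 :=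
      Nat.cast_ne_zero.2 Nat.card_pos.ne'
    refine mul_left_cancel₀ hcard' (hnorm.trans ?_)
    rw [card_GL_zmod, card_GL_zmod,
      ← prod_filter_mul_prod_filter_not n.primeFactors (fun p => p ∣ m)]
    have hpf : n.primeFactors.filter (fun p => p ∣ m) = m.primeFactors := by
      ext p
      simp only [mem_filter, Nat.mem_primeFactors]
      exact ⟨fun h => ⟨h.1.1, h.2, NeZero.ne m⟩, fun h => ⟨⟨h.1, h.2.1.trans hmn, hn⟩, h.2.1⟩⟩
    have hexp : r ^ 2 = r * (r - 1) / 2 + r * (r + 1) / 2 := by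
      obtain ⟨k, rfl⟩ : ∃ k, r = k + 1 := ⟨r - 1, by omega⟩
      have h1 : 2 ∣ (k + 1) * k := by rw [mul_comm]; exact (Nat.even_mul_succ_self k).two_dvd
      have h2 : 2 ∣ (k + 1) * (k + 1 + 1) := (Nat.even_mul_succ_self (k + 1)).two_dvd
      rw [Nat.add_sub_cancel, ← Nat.add_div_of_dvd_right h1]
      have : (k + 1) * k + (k + 1) * (k + 1 + 1) = 2 * (k + 1) ^ 2 := by ring
      omega
    have hnr : (n : ℝ) = d * m := by exact_mod_cast hd
    rw [hpf, hexp, hnr]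
    ring
  · intro h
    have h0 := gaussSum_zmodChar_eq_zero χ' hζ (fun h' => h ⟨hf, h'⟩)
    rw [h0, zero_pow hr.ne', mul_zero, mul_zero] at key
    exact (mul_eq_zero.1 key).resolve_left hcard
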